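/- Identify $\mathbb{R}^2$ with $\mathbb{C}$, write $x=(x_1,x_2)$, $x^\perp=(-x_2,x_1)$, $\bar x=(x_1,-x_2)$ and $\nabla^\perp=(\nabla\,\cdot\,)^\perp$. Let $\Omega$ be the half-plane $\mathbb{H}=\{x\in\mathbb{R}^2 : x_2>0\}$ or the unit disk $\mathbb{D}=\{x\in\mathbb{R}^2 : |x|<1\}$, let $$\gamma_{\mathbb H}(x,y)=-\frac1{2\pi}\ln|x-\bar y|,\qquad \gamma_{\mathbb D}(x,y)=-\frac1{2\pi}\ln|1-x\bar y|,$$ let $G_\Omega(x,y)=\frac1{2\pi}\ln|x-y|+\gamma_\Omega(x,y)$ be Green's function of $\Omega$ and $\tilde\gamma_\Omega(x)=\gamma_\Omega(x,x)$ its Robin function (here $x\bar y$ is the product of complex numbers). Let $a_1,\dots,a_N>0$, let $x_1^0,\dots,x_N^0\in\Omega$ be pairwise distinct, and let $0<T<\infty$. Let $x_1,\dots,x_N:[0,T)\to\Omega$ be a solution of the point-vortex system on $[0,T)$, that is, $x_i(0)=x_i^0$, the points $x_i(t)$ are pairwise distinct for every $t\in[0,T)$, and $$\frac{\mathrm d}{\mathrm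 dt}x_i(t)=\sum_{j\ne i}a_j\nabla_x^\perp G_\Omega(x_i(t),x_j(t))+\frac{a_i}{2}\nabla^\perp\tilde\gamma_\Omega(x_i(t)),\qquad t\in[0,T),\ 1\le i\le N.$$ Then no vortex collapses with the boundary at time $T$: the set $$Q=\Big\{i\in\{1,\dots,N\} : \liminf_{t\to T^-}\operatorname{dist}(x_i(t),\partial\Omega)=0\Big\}$$ is empty. -/

import Mathlib

open Filter Topology

noncomputable section

/-! The plane `ℝ²` is identified with `ℂ` (an inner product space over `ℝ` with the Euclidean
norm); a point `(x₁, x₂)` is `x₁ + i x₂`. -/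

namespace PointVortex

/-- The two domains considered: the upper half-plane and the unit disk. -/
inductive Domain
  | halfPlane
  | unitDisk

/-- The open set of the plane denoted by a `Domain`:
`{x : x₂ > 0}`, respectively `{x : |x| < 1}`. -/
def Domain.carrier : Domain → Set ℂ
  | .halfPlane => {x | 0 < x.im}
  | .unitDisk => Metric.ball 0 1

/-- Green's function of the whole plane, `(1 / 2π) ln |x - y|`. -/
def greenPlane (x y : ℂ) : ℝ := 1 / (2 * Real.pi) * Real.log ‖x - y‖

/-- The regular part `γ_Ω(x, y)` of Green's function. For the half-plane it is
`-(1 / 2π) ln |x - ȳ|`. For the disk it is `-(1 / 2π) ln (|x - y*| |y|)` with `y* = y / |y|²`;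
the product `|x - y*| |y|` is written as `|1 - x ȳ|`, which also covers `y = 0`. -/
def Domain.regularPart : Domain → ℂ → ℂ → ℝ
  | .halfPlane, x, y => -(1 / (2 * Real.pi)) * Real.log ‖x - (starRingEnd ℂ) y‖
  | .unitDisk, x, y => -(1 / (2 * Real.pi)) * Real.log ‖1 - x * (starRingEnd ℂ) y‖

/-- Green's function `G_Ω = G_{ℝ²} + γ_Ω` of the domain. -/
def Domain.green (Ω : Domain) (x y : ℂ) : ℝ := greenPlane x y + Ω.regularPart x y

/-- The regular part `γ_Ω(·, y)` is harmonic in `Ω`, so that `Δ_x G_Ω(·, y) = δ_y`. -/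
theorem Domain.harmonicAt_regularPart (Ω : Domain) {x y : ℂ} (hx : x ∈ Ω.carrier)
    (hy : y ∈ Ω.carrier) :
    InnerProductSpace.HarmonicAt (fun z => Ω.regularPart z y) x := by
  cases Ω with
  | halfPlane =>
    have hx' : 0 < x.im := hx
    have hy' : 0 < y.im := hy
    have h0 : x - (starRingEnd ℂ) y ≠ 0 := by
      intro h
      have := congrArg Complex.im h
      simp at this
      linarith
    have := (AnalyticAt.harmonicAt_log_norm (f := fun z : ℂ => z - (starRingEnd ℂ) y)
      (z := x) (by fun_prop) h0).const_smul (c := -(1 / (2 * Real.pi)))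
    exact this
  | unitDisk =>
    have hx' : ‖x‖ < 1 := by simpa [Domain.carrier] using hx
    have hy' : ‖y‖ < 1 := by simpa [Domain.carrier] using hy
    have h0 : 1 - x * (starRingEnd ℂ) y ≠ 0 := by
      intro h
      have h1 : ‖x * (starRingEnd ℂ) y‖ = 1 := by rw [← sub_eq_zero.mp h]; simp
      rw [norm_mul, RCLike.norm_conj] at h1
      nlinarith [norm_nonneg x, norm_nonneg y]
    have := (AnalyticAt.harmonicAt_log_norm (f := fun z : ℂ => 1 - z * (starRingEnd ℂ) y)
      (z := x) (by fun_prop) h0).const_smul (c := -(1 / (2 * Real.pi)))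
    exact this

/-- Green's function vanishes on the boundary of the domain. -/
theorem Domain.green_eq_zero_of_mem_frontier (Ω : Domain) {x : ℂ} (y : ℂ)
    (hx : x ∈ frontier Ω.carrier) : Ω.green x y = 0 := by
  cases Ω with
  | halfPlane =>
    have hx' : x.im = 0 := by
      have : x ∈ frontier {z : ℂ | 0 < z.im} := hx
      rwa [Complex.frontier_setOfPred_lt_im] at this
    have h : ‖x - (starRingEnd ℂ) y‖ = ‖x - y‖ := by
      rw [← RCLike.norm_conj (x - y), map_sub, Complex.conj_eq_iff_im.mpr hx']
    simp [Domain.green, greenPlane, Domain.regularPart, h]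
  | unitDisk =>
    have hx' : ‖x‖ = 1 := by
      have : x ∈ frontier (Metric.ball (0 : ℂ) 1) := hx
      simpa [frontier_ball (0 : ℂ) one_ne_zero] using this
    have h1 : x * (starRingEnd ℂ) x = 1 := by
      rw [Complex.mul_conj, Complex.normSq_eq_norm_sq, hx']; simp
    have h : ‖1 - x * (starRingEnd ℂ) y‖ = ‖x - y‖ := by
      rw [← h1, ← mul_sub, norm_mul, hx', one_mul, ← map_sub, RCLike.norm_conj]
    simp [Domain.green, greenPlane, Domain.regularPart, h]

/-- Robin's function `x ↦ γ_Ω(x, x)` of the domain. -/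
def Domain.robin (Ω : Domain) (x : ℂ) : ℝ := Ω.regularPart x x

/-- `∇^⊥ f (x)`: the gradient of `f` rotated counterclockwise by `π / 2`. -/
def perpGrad (f : ℂ → ℝ) (x : ℂ) : ℂ := Complex.I * gradient f x

/-- The velocity of the `i`-th vortex in the configuration `X`,
`∑_{j ≠ i} a_j ∇_x^⊥ G_Ω(x_i, x_j) + (a_i / 2) ∇^⊥ γ̃_Ω(x_i)`. -/
def velocity (Ω : Domain) {N : ℕ} (a : Fin N → ℝ) (X : Fin N → ℂ) (i : Fin N) : ℂ :=
  ∑ j ∈ Finset.univ.erase i, (a j : ℂ) * perpGrad (fun z => Ω.green z (X j)) (X i)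
    + ((a i / 2 : ℝ) : ℂ) * perpGrad Ω.robin (X i)

/-- `x` solves the point-vortex system in `Ω` on `[0, T)` with intensities `a` and initial
positions `x₀`: the vortices stay in `Ω` and pairwise distinct on `[0, T)`, and the equations of
motion hold there (with the right derivative at `t = 0`). -/
structure IsSolution (Ω : Domain) {N : ℕ} (a : Fin N → ℝ) (x₀ : Fin N → ℂ) (T : ℝ)
    (x : Fin N → ℝ → ℂ) : Prop where
  initial : ∀ i, x i 0 = x₀ i
  mem_domain : ∀ t ∈ Set.Ico 0 T, ∀ i, x i t ∈ Ω.carrier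
  distinct : ∀ t ∈ Set.Ico 0 T, ∀ i j, i ≠ j → x i t ≠ x j t
  motion : ∀ t ∈ Set.Ico 0 T, ∀ i,
    HasDerivWithinAt (x i) (velocity Ω a (fun j => x j t) i) (Set.Ico 0 T) t

/-- The set `Q` of the vortices collapsing with the boundary at time `T`:
`liminf_{t → T⁻} dist(x_i(t), ∂Ω) = 0`. The distance and the lower limit are taken in `[0, ∞]`,
so that the lower limit always has its true value. -/
def boundaryCluster (Ω : Domain) {N : ℕ} (T : ℝ) (x : Fin N → ℝ → ℂ) : Set (Fin N) :=
  {i | liminf (fun t => Metric.infEDist (x i t) (frontier Ω.carrier)) (𝓝[<] T) = 0}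

end PointVortex

end

/-! In both domains take a height that is positive inside and zero on the boundary: `x.im` in the
half-plane, `1 - ‖x‖ ^ 2` in the disk. The Robin term moves a vortex along the level sets of its
height, so heights change only through a kernel `K`, antisymmetric under exchange of the two
vortices. Besides antisymmetry the argument needs only that `|K|` times the height gap is bounded
and that `|K|` times its cube is at most a constant times the product of the heights.

Symmetrizing the double sum replaces `K i j * p i` by `K i j * (p i - p j)`. Hence the weighted sum
of heights is conserved, and weighted sums of a polynomial in the heights are Lipschitz in time,
even through collisions of vortices.

Suppose a height approaches 0 along times tending to `T`. On a subsequence all heights converge; a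
polynomial vanishing at the limits shows that near `T` the heights split into a low and a high group
separated by a gap (`exists_gap`). Within the low group interactions cancel, and across the gap the
cubic bound makes `K` linear in the low height. So the total low height `F` satisfies `|F'| ≤ C F`
and stays away from 0, although it tends to 0 along the subsequence (`exists_eventually_le`). -/

namespace PointVortex

/-! ### Antisymmetric pair sums and logarithmic gradients -/

/-- Symmetrization of a double sum with an antisymmetric kernel. -/
theorem two_mul_sum_antisymm {N : ℕ} (a p : Fin N → ℝ) (K : Fin N → Fin N → ℝ)
    (hK : ∀ i j, K j i = -K i j) :
    2 * ∑ i, a i * (p i * ∑ j ∈ Finset.univ.erase i, a j * K i j) =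
      ∑ i, ∑ j, a i * a j * (K i j * (p i - p j)) := by
  have hd : ∀ i, K i i = 0 := fun i => by have := hK i i; linarith
  have h1 : ∑ i, a i * (p i * ∑ j ∈ Finset.univ.erase i, a j * K i j) =
      ∑ i, ∑ j, a i * a j * (K i j * p i) := by
    refine Finset.sum_congr rfl fun i _ => ?_
    rw [Finset.sum_erase _ (by simp [hd i]), Finset.mul_sum, Finset.mul_sum]
    exact Finset.sum_congr rfl fun j _ => by ring
  have h2 : ∑ i, ∑ j, a i * a j * (K i j * p i) = -∑ i, ∑ j, a i * a j * (K i j * p j) := by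
    rw [Finset.sum_comm, ← Finset.sum_neg_distrib]
    refine Finset.sum_congr rfl fun i _ => ?_
    rw [← Finset.sum_neg_distrib]
    exact Finset.sum_congr rfl fun j _ => by rw [hK i j]; ring
  have h3 : ∑ i, ∑ j, a i * a j * (K i j * (p i - p j)) =
      ∑ i, ∑ j, a i * a j * (K i j * p i) - ∑ i, ∑ j, a i * a j * (K i j * p j) := by
    rw [← Finset.sum_sub_distrib]
    refine Finset.sum_congr rfl fun i _ => ?_
    rw [← Finset.sum_sub_distrib]
    exact Finset.sum_congr rfl fun j _ => by ring
  rw [h3, h1]; linarith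

/-- After symmetrization only differences of `p` meet the singular kernel. An additive bound `q i +
q j` lets the double sum factor. -/
theorem abs_sum_antisymm_le {N : ℕ} {a p q : Fin N → ℝ} {K : Fin N → Fin N → ℝ}
    (ha : ∀ i, 0 < a i) (hK : ∀ i j, K j i = -K i j)
    (hq : ∀ i j, |K i j * (p i - p j)| ≤ q i + q j) :
    |∑ i, a i * (p i * ∑ j ∈ Finset.univ.erase i, a j * K i j)| ≤
      (∑ i, a i) * ∑ i, a i * q i := by
  have h1 := two_mul_sum_antisymm a p K hK
  have h2 : |∑ i, ∑ j, a i * a j * (K i j * (p i - p j))| ≤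
      ∑ i, ∑ j, a i * a j * (q i + q j) := by
    refine (Finset.abs_sum_le_sum_abs _ _).trans (Finset.sum_le_sum fun i _ => ?_)
    refine (Finset.abs_sum_le_sum_abs _ _).trans (Finset.sum_le_sum fun j _ => ?_)
    have h0 := mul_pos (ha i) (ha j)
    rw [abs_mul, abs_of_pos h0]
    exact mul_le_mul_of_nonneg_left (hq i j) h0.le
  have h3 : ∑ i, ∑ j, a i * a j * (q i + q j) = 2 * ((∑ i, a i) * ∑ i, a i * q i) := by
    have e1 : (∑ i, a i) * ∑ i, a i * q i = ∑ i, ∑ j, a i * a j * q j := by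
      rw [Finset.sum_mul_sum]
      exact Finset.sum_congr rfl fun i _ => Finset.sum_congr rfl fun j _ => by ring
    have e2 : ∑ i, ∑ j, a i * a j * q j = ∑ i, ∑ j, a i * a j * q i := by
      rw [Finset.sum_comm]
      exact Finset.sum_congr rfl fun i _ => Finset.sum_congr rfl fun j _ => by ring
    have e3 : ∑ i, ∑ j, a i * a j * (q i + q j) =
        ∑ i, ∑ j, a i * a j * q i + ∑ i, ∑ j, a i * a j * q j := by
      rw [← Finset.sum_add_distrib]
      refine Finset.sum_congr rfl fun i _ => ?_
      rw [← Finset.sum_add_distrib]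
      exact Finset.sum_congr rfl fun j _ => by ring
    rw [e3, ← e2, e1]; ring
  rw [← h1, h3, abs_mul, abs_two] at h2
  linarith

theorem hasGradientAt_log_norm_affine (c d : ℂ) {z : ℂ} (hz : c * z + d ≠ 0) :
    HasGradientAt (fun z : ℂ => Real.log ‖c * z + d‖)
      ((((‖c * z + d‖ ^ 2)⁻¹ : ℝ) : ℂ) * ((starRingEnd ℂ) c * (c * z + d))) z := by
  set u := c * z + d with hu
  have h0 : ‖u‖ ^ 2 ≠ 0 := by positivity
  have h := ((hasStrictFDerivAt_norm_sq u).hasFDerivAt.log h0).const_mul (1 / 2 : ℝ)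
  have hl : HasFDerivAt (fun z : ℂ => c * z + d) (c • ContinuousLinearMap.id ℝ ℂ) z :=
    ((hasFDerivAt_id z).const_mul c).add_const d
  rw [hasGradientAt_iff_hasFDerivAt]
  refine ((h.comp z hl).congr_fderiv ?_).congr_of_eventuallyEq (Eventually.of_forall fun z => ?_)
  · refine ContinuousLinearMap.ext fun v => ?_
    simp [innerSL_apply_apply, -Complex.ofReal_inv]
    ring
  · simp [Real.log_pow]

end PointVortex

namespace PointVortex

/-! ### Differential inequalities -/

theorem abs_sub_le_of_hasDerivWithinAt_Ico {T C : ℝ} {F F' : ℝ → ℝ}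
    (hF : ∀ t ∈ Set.Ico 0 T, HasDerivWithinAt F (F' t) (Set.Ico 0 T) t)
    (hC : ∀ t ∈ Set.Ico 0 T, |F' t| ≤ C) {s t : ℝ} (hs : s ∈ Set.Ico 0 T)
    (ht : t ∈ Set.Ico 0 T) : |F t - F s| ≤ C * |t - s| :=
  (convex_Ico 0 T).norm_image_sub_le_of_norm_hasDerivWithin_le hF hC hs ht

/-- A positive quantity with `|F'| ≤ C F` on a bounded interval stays away from zero. -/
theorem exists_pos_le_of_abs_deriv_le {s T C : ℝ} {F F' : ℝ → ℝ}
    (hF : ∀ t ∈ Set.Ico s T, HasDerivWithinAt F (F' t) (Set.Ico s T) t)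
    (hC : ∀ t ∈ Set.Ico s T, |F' t| ≤ C * F t) (hs : 0 < F s) (hsT : s < T) :
    ∃ c > 0, ∀ t ∈ Set.Ico s T, c ≤ F t := by
  have hd : ∀ t ∈ Set.Ico s T, HasDerivWithinAt (fun t => Real.exp (C * t) * F t)
      (Real.exp (C * t) * C * F t + Real.exp (C * t) * F' t) (Set.Ico s T) t := by
    intro t ht
    have := ((hasDerivAt_id t).const_mul C).exp.hasDerivWithinAt.fun_mul (hF t ht)
    simpa using this
  have hmono : MonotoneOn (fun t => Real.exp (C * t) * F t) (Set.Ico s T) := by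
    refine monotoneOn_of_hasDerivWithinAt_nonneg (convex_Ico s T)
      (fun t ht => (hd t ht).continuousWithinAt)
      (fun t ht => (hd t (interior_subset ht)).mono interior_subset) fun t ht => ?_
    have h1 := neg_le_of_abs_le (hC t (interior_subset ht))
    have h2 := Real.exp_pos (C * t)
    nlinarith
  have hs' : s ∈ Set.Ico s T := ⟨le_rfl, hsT⟩
  -- Using `|C|` gives one bound valid for either sign of `C`.
  refine ⟨Real.exp (-(|C| * (T - s))) * F s, by positivity, fun t ht => ?_⟩
  have h1 := hmono hs' ht ht.1
  simp only at h1
  have h2 : F t = Real.exp (-(C * t)) * (Real.exp (C * t) * F t) := by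
    rw [← mul_assoc, ← Real.exp_add]; simp
  have h3 : Real.exp (-(|C| * (T - s))) ≤ Real.exp (-(C * t)) * Real.exp (C * s) := by
    rw [← Real.exp_add]
    refine Real.exp_le_exp.2 ?_
    have := le_abs_self C
    have := abs_nonneg C
    nlinarith [ht.1, ht.2, mul_nonneg (abs_nonneg C) (sub_nonneg.2 ht.2.le),
      mul_nonneg (sub_nonneg.2 (le_abs_self C)) (sub_nonneg.2 ht.1)]
  rw [h2]
  calc _ ≤ Real.exp (-(C * t)) * Real.exp (C * s) * F s := by gcongr
    _ = Real.exp (-(C * t)) * (Real.exp (C * s) * F s) := by ring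
    _ ≤ _ := by gcongr

/-! ### Abstract height flows: conservation, Lipschitz sums, gap -/

/-- Heights `h i` of weighted particles driven on `[0, T)` by an antisymmetric pair
interaction `K`, which is controlled in terms of the height differences. -/
structure IsHeightFlow {N : ℕ} (a : Fin N → ℝ) (T C : ℝ) (h : Fin N → ℝ → ℝ)
    (K : Fin N → Fin N → ℝ → ℝ) : Prop where
  weight_pos : ∀ i, 0 < a i
  pos : ∀ t ∈ Set.Ico 0 T, ∀ i, 0 < h i t
  antisymm : ∀ t ∈ Set.Ico 0 T, ∀ i j, K j i t = -K i j t
  deriv : ∀ t ∈ Set.Ico 0 T, ∀ i, HasDerivWithinAt (h i)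
    (∑ j ∈ Finset.univ.erase i, a j * K i j t) (Set.Ico 0 T) t
  abs_mul_le : ∀ t ∈ Set.Ico 0 T, ∀ i j, |K i j t| * |h i t - h j t| ≤ C
  abs_mul_pow_le : ∀ t ∈ Set.Ico 0 T, ∀ i j,
    |K i j t| * |h i t - h j t| ^ 3 ≤ C * (h i t * h j t)

namespace IsHeightFlow

variable {N : ℕ} {a : Fin N → ℝ} {T C : ℝ} {h : Fin N → ℝ → ℝ} {K : Fin N → Fin N → ℝ → ℝ}

theorem hasDerivWithinAt_sum (H : IsHeightFlow a T C h K) {f : ℝ → ℝ} {p : Fin N → ℝ} {t : ℝ}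
    (ht : t ∈ Set.Ico 0 T) (hf : ∀ i, HasDerivAt f (p i) (h i t)) :
    HasDerivWithinAt (fun t => ∑ i, a i * f (h i t))
      (∑ i, a i * (p i * ∑ j ∈ Finset.univ.erase i, a j * K i j t)) (Set.Ico 0 T) t :=
  HasDerivWithinAt.fun_sum fun i _ =>
    ((hf i).comp_hasDerivWithinAt t (H.deriv t ht i)).const_mul (a i)

theorem exists_le (H : IsHeightFlow a T C h K) (hT : 0 < T) :
    ∃ M > 0, ∀ t ∈ Set.Ico 0 T, ∀ i, h i t ≤ M := by
  have h0 : (0 : ℝ) ∈ Set.Ico 0 T := ⟨le_rfl, hT⟩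
  set S := ∑ i, a i * h i 0
  have hcons : ∀ t ∈ Set.Ico 0 T, ∑ i, a i * h i t = S := by
    intro t ht
    -- With `p = 1` every difference vanishes, so the weighted total is constant.
    have := abs_sub_le_of_hasDerivWithinAt_Ico (C := 0)
      (fun t ht => H.hasDerivWithinAt_sum (f := id) (p := fun _ => 1) ht
        fun i => hasDerivAt_id _) (fun t ht => by
          simpa using abs_sum_antisymm_le (q := fun _ => 0) (p := fun _ => 1) H.weight_pos
            (H.antisymm t ht) (by simp)) h0 ht
    simp only [id, zero_mul] at this
    exact sub_eq_zero.1 (abs_nonpos_iff.1 this)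
  have hS : 0 ≤ S := Finset.sum_nonneg fun i _ => (mul_pos (H.weight_pos i) (H.pos 0 h0 i)).le
  have hle : ∀ t ∈ Set.Ico 0 T, ∀ i, h i t ≤ S / a i := by
    intro t ht i
    rw [le_div_iff₀ (H.weight_pos i), ← hcons t ht, mul_comm]
    exact Finset.single_le_sum (f := fun i => a i * h i t)
      (fun i _ => (mul_pos (H.weight_pos i) (H.pos t ht i)).le) (Finset.mem_univ i)
  have hnn : ∀ i, 0 ≤ S / a i := fun i => div_nonneg hS (H.weight_pos i).le
  -- The added 1 keeps the bound positive when there are no vortices.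
  refine ⟨∑ i, S / a i + 1, ?_, fun t ht i => (hle t ht i).trans ?_⟩
  · have := Finset.sum_nonneg fun i (_ : i ∈ Finset.univ) => hnn i
    linarith
  · have := Finset.single_le_sum (f := fun i => S / a i) (fun i _ => hnn i) (Finset.mem_univ i)
    linarith

/-- Sums of a fixed polynomial of the heights are Lipschitz in time. -/
theorem exists_abs_sum_eval_sub_le (H : IsHeightFlow a T C h K) (hT : 0 < T)
    (P : Polynomial ℝ) :
    ∃ L ≥ 0, ∀ s ∈ Set.Ico 0 T, ∀ t ∈ Set.Ico 0 T,
      |∑ i, a i * P.eval (h i t) - ∑ i, a i * P.eval (h i s)| ≤ L * |t - s| := by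
  obtain ⟨M, hM, hle⟩ := H.exists_le hT
  -- A bound on `P''` makes `P'` Lipschitz on the range of heights; the difference this produces is
  -- absorbed by `abs_mul_le`.
  obtain ⟨B, hB⟩ := (isCompact_Icc (a := (0 : ℝ)) (b := M)).exists_bound_of_continuousOn
    (f := fun y => P.derivative.derivative.eval y) (by fun_prop)
  have hB0 : 0 ≤ B := (norm_nonneg _).trans (hB 0 ⟨le_rfl, hM.le⟩)
  have hC0 : ∀ t ∈ Set.Ico 0 T, ∀ i : Fin N, 0 ≤ C := fun t ht i =>
    (by positivity : 0 ≤ |K i i t| * |h i t - h i t|).trans (H.abs_mul_le t ht i i)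
  have hb : ∀ t ∈ Set.Ico 0 T, ∀ i j, |K i j t * (P.derivative.eval (h i t) -
      P.derivative.eval (h j t))| ≤ B * |C| / 2 + B * |C| / 2 := by
    intro t ht i j
    have hmem : ∀ i, h i t ∈ Set.Icc 0 M := fun i => ⟨(H.pos t ht i).le, hle t ht i⟩
    have h1 := (convex_Icc 0 M).norm_image_sub_le_of_norm_hasDerivWithin_le
      (fun y _ => (P.derivative.hasDerivAt y).hasDerivWithinAt) hB (hmem j) (hmem i)
    rw [Real.norm_eq_abs, Real.norm_eq_abs] at h1
    have h2 := H.abs_mul_le t ht i j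
    have h3 := le_abs_self C
    calc _ = |K i j t| * |P.derivative.eval (h i t) - P.derivative.eval (h j t)| := abs_mul _ _
      _ ≤ |K i j t| * (B * |h i t - h j t|) := by gcongr
      _ = B * (|K i j t| * |h i t - h j t|) := by ring
      _ ≤ B * |C| := by gcongr; linarith
      _ = _ := by ring
  have ha := fun i => (H.weight_pos i).le
  refine ⟨(∑ i, a i) * ∑ i, a i * (B * |C| / 2), mul_nonneg
    (Finset.sum_nonneg fun i _ => ha i)
    (Finset.sum_nonneg fun i _ => mul_nonneg (ha i) (by positivity)), fun s hs t ht => ?_⟩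
  exact abs_sub_le_of_hasDerivWithinAt_Ico
    (fun t ht => H.hasDerivWithinAt_sum ht fun i => P.hasDerivAt (h i t))
    (fun t ht => abs_sum_antisymm_le H.weight_pos (H.antisymm t ht) (hb t ht)) hs ht

/-- If along a sequence of times the heights converge to limits which avoid `(0, η)`, then no
height is in the middle third of `(0, η)` at times close to `T`. -/
theorem exists_gap (H : IsHeightFlow a T C h K) (hT : 0 < T) {u : ℕ → ℝ}
    (hu : ∀ n, u n ∈ Set.Ico 0 T) (huT : Tendsto u atTop (𝓝 T)) {Y : Fin N → ℝ}
    (hY : ∀ i, Tendsto (fun n => h i (u n)) atTop (𝓝 (Y i))) {η : ℝ} (hη : 0 < η)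
    (hYη : ∀ i, Y i ≤ 0 ∨ η ≤ Y i) :
    ∃ s ∈ Set.Ico 0 T, ∀ t ∈ Set.Ico s T, ∀ i, h i t < η / 3 ∨ 2 * η / 3 < h i t := by
  classical
  -- Nonnegative and zero at every limit height, so its weighted sum measures closeness to the set
  -- of limits.
  set P : Polynomial ℝ := ∏ k, (Polynomial.X - Polynomial.C (Y k)) ^ 2 with hP
  have hev : ∀ y, P.eval y = ∏ k, (y - Y k) ^ 2 := fun y => by
    simp [hP, Polynomial.eval_prod]
  obtain ⟨L, hL, hLip⟩ := H.exists_abs_sum_eval_sub_le hT P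
  have hlim : Tendsto (fun n => ∑ i, a i * P.eval (h i (u n))) atTop (𝓝 0) := by
    have h0 : ∑ i, a i * P.eval (Y i) = 0 := Finset.sum_eq_zero fun i _ => by
      rw [hev, Finset.prod_eq_zero (Finset.mem_univ i) (by simp), mul_zero]
    rw [← h0]
    exact tendsto_finsetSum _ fun i _ => ((P.continuous.tendsto _).comp (hY i)).const_mul _
  -- Compare time `t` with `u n` and let `n` grow: the estimate passes from the sequence to all
  -- times.
  have hbound : ∀ t ∈ Set.Ico 0 T, ∑ i, a i * P.eval (h i t) ≤ L * (T - t) := by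
    intro t ht
    have h1 : Tendsto (fun n => ∑ i, a i * P.eval (h i (u n)) + L * |t - u n|) atTop
        (𝓝 (0 + L * |t - T|)) :=
      hlim.add ((tendsto_const_nhds.sub huT).abs.const_mul L)
    rw [zero_add, abs_sub_comm, abs_of_nonneg (sub_nonneg.2 ht.2.le)] at h1
    refine ge_of_tendsto h1 (Eventually.of_forall fun n => ?_)
    have := le_of_abs_le (hLip (u n) (hu n) t ht)
    linarith
  -- A point of the middle third lies at distance at least `η / 3` from each `Y k`, so each of the
  -- `N` factors is at least `(η / 3) ^ 2`.
  set m := ((η / 3) ^ 2) ^ N with hm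
  have hm0 : 0 < m := by positivity
  have hev' : ∀ᶠ t in 𝓝[<] T, ∀ i, L * (T - t) < a i * m := by
    rw [eventually_all]
    intro i
    have h1 : Tendsto (fun t => L * (T - t)) (𝓝[<] T) (𝓝 (L * (T - T))) :=
      ((continuous_const.sub continuous_id).const_mul L).continuousAt.tendsto.mono_left
        nhdsWithin_le_nhds
    rw [sub_self, mul_zero] at h1
    exact h1.eventually_lt_const (mul_pos (H.weight_pos i) hm0)
  have hsm := hev'.and (Ico_mem_nhdsLT hT)
  obtain ⟨s, hsT, hs⟩ := mem_nhdsLT_iff_exists_Ico_subset.1 hsm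
  have hs0 : s ∈ Set.Ico 0 T := (hs ⟨le_rfl, hsT⟩).2
  refine ⟨s, hs0, fun t ht i => ?_⟩
  have ht0 : t ∈ Set.Ico 0 T := ⟨hs0.1.trans ht.1, ht.2⟩
  by_contra! hcon
  have h1 : m ≤ P.eval (h i t) := by
    rw [hev, hm]
    have : ((η / 3) ^ 2) ^ N = ∏ k : Fin N, (η / 3) ^ 2 := by simp
    rw [this]
    refine Finset.prod_le_prod (fun k _ => by positivity) fun k _ => ?_
    rcases hYη k with hk | hk <;> nlinarith
  have h2 : a i * P.eval (h i t) ≤ ∑ i, a i * P.eval (h i t) :=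
    Finset.single_le_sum (f := fun i => a i * P.eval (h i t)) (fun i _ => by
      have := H.weight_pos i
      rw [hev]
      exact mul_nonneg this.le (Finset.prod_nonneg fun k _ => sq_nonneg _)) (Finset.mem_univ i)
  have h3 := (hs ht).1 i
  have h4 := mul_le_mul_of_nonneg_left h1 (H.weight_pos i).le
  have h5 := hbound t ht0
  linarith

end IsHeightFlow
end PointVortex

/-! ### Abstract height flows: no height collapses -/

namespace PointVortex
namespace IsHeightFlow

variable {N : ℕ} {a : Fin N → ℝ} {T C : ℝ} {h : Fin N → ℝ → ℝ} {K : Fin N → Fin N → ℝ → ℝ}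

theorem exists_seq_tendsto (H : IsHeightFlow a T C h K) (hT : 0 < T) {i₀ : Fin N}
    (hi₀ : ∀ c > 0, ∃ᶠ t in 𝓝[<] T, h i₀ t < c) :
    ∃ (u : ℕ → ℝ) (Y : Fin N → ℝ), (∀ n, u n ∈ Set.Ico 0 T) ∧ Tendsto u atTop (𝓝 T) ∧
      (∀ i, Tendsto (fun n => h i (u n)) atTop (𝓝 (Y i))) ∧ Y i₀ = 0 := by
  obtain ⟨M, hM, hle⟩ := H.exists_le hT
  have hpos : ∀ n : ℕ, (0 : ℝ) < 1 / ((n : ℝ) + 1) := fun n => Nat.one_div_pos_of_nat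
  have hex : ∀ n : ℕ, ∃ t, h i₀ t < 1 / ((n : ℝ) + 1) ∧
      t ∈ Set.Ico 0 T ∧ t ∈ Set.Ico (T - 1 / ((n : ℝ) + 1)) T := fun n =>
    ((hi₀ _ (hpos n)).and_eventually (Filter.inter_mem (Ico_mem_nhdsLT hT)
      (Ico_mem_nhdsLT (sub_lt_self T (hpos n))))).exists
  choose u hu1 hu2 hu3 using hex
  obtain ⟨Y, -, φ, hφ, hY⟩ := (isCompact_Icc (a := (0 : Fin N → ℝ)) (b := fun _ => M)).tendsto_subseq
    (x := fun n i => h i (u n)) fun n =>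
      ⟨fun i => (H.pos _ (hu2 n) i).le, fun i => hle _ (hu2 n) i⟩
  have hY' : ∀ i, Tendsto (fun n => h i (u (φ n))) atTop (𝓝 (Y i)) := fun i =>
    (tendsto_pi_nhds.1 hY) i
  have h0 : Tendsto (fun n : ℕ => 1 / ((n : ℝ) + 1)) atTop (𝓝 0) :=
    tendsto_one_div_add_atTop_nhds_zero_nat
  have huT : Tendsto u atTop (𝓝 T) := by
    refine tendsto_of_tendsto_of_tendsto_of_le_of_le (g := fun n : ℕ => T - 1 / ((n : ℝ) + 1))
      ?_ tendsto_const_nhds (fun n => (hu3 n).1) (fun n => (hu3 n).2.le)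
    simpa using tendsto_const_nhds.sub h0
  refine ⟨u ∘ φ, Y, fun n => hu2 _, huT.comp hφ.tendsto_atTop, hY', ?_⟩
  refine tendsto_nhds_unique (hY' i₀) ?_
  exact squeeze_zero (fun n => (H.pos _ (hu2 _) i₀).le) (fun n => (hu1 _).le)
    (h0.comp hφ.tendsto_atTop)

/-- The identity on `(-∞, b)`, and zero on `[b, ∞)`. -/
noncomputable def truncId (b y : ℝ) : ℝ := if y < b then y else 0

/-- The jump at `b` is harmless once `b` is placed inside a gap that no height enters. -/
theorem hasDerivAt_truncId {b y : ℝ} (hy : y ≠ b) :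
    HasDerivAt (truncId b) (if y < b then 1 else 0) y := by
  rcases hy.lt_or_gt with hlt | hgt
  · rw [if_pos hlt]
    refine (hasDerivAt_id y).congr_of_eventuallyEq ?_
    filter_upwards [eventually_lt_nhds hlt] with z hz
    simp [truncId, hz]
  · rw [if_neg hgt.le.not_gt]
    refine (hasDerivAt_const y (0 : ℝ)).congr_of_eventuallyEq ?_
    filter_upwards [eventually_gt_nhds hgt] with z hz
    simp [truncId, hz.le]

theorem truncId_nonneg {b y : ℝ} (hy : 0 ≤ y) : 0 ≤ truncId b y := by
  unfold truncId; split_ifs <;> simp [hy]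

/-- No height tends to zero, even along a sequence of times. -/
theorem exists_eventually_le (H : IsHeightFlow a T C h K) (hT : 0 < T) (i₀ : Fin N) :
    ∃ c > 0, ∀ᶠ t in 𝓝[<] T, c ≤ h i₀ t := by
  by_contra! hcon
  have hi₀ : ∀ c > 0, ∃ᶠ t in 𝓝[<] T, h i₀ t < c := fun c hc => by
    simpa [Filter.not_eventually] using hcon c hc
  obtain ⟨u, Y, hu, huT, hY, hY0⟩ := H.exists_seq_tendsto hT hi₀
  obtain ⟨M, hM, hle⟩ := H.exists_le hT
  -- The minimum lies below every positive limit; the value 1 for the others keeps it positive even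
  -- if all limits are 0.
  obtain ⟨k, -, hk⟩ := Finset.exists_min_image Finset.univ
    (fun i => if 0 < Y i then Y i else 1) ⟨i₀, Finset.mem_univ _⟩
  set η := if 0 < Y k then Y k else 1 with hηdef
  have hη : 0 < η := by rw [hηdef]; split_ifs with h1 <;> [exact h1; exact one_pos]
  have hYη : ∀ i, Y i ≤ 0 ∨ η ≤ Y i := fun i => by
    rcases le_or_gt (Y i) 0 with h1 | h1
    · exact Or.inl h1
    · have := hk i (Finset.mem_univ i)
      rw [if_pos h1] at this
      exact Or.inr this
  obtain ⟨s, hs, hgap⟩ := H.exists_gap hT hu huT hY hη hYη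
  obtain ⟨n, hn1, hn2⟩ : ∃ n, s < u n ∧ h i₀ (u n) < η / 2 :=
    ((huT.eventually_const_lt hs.2).and
      ((hY i₀).eventually_lt_const (by rw [hY0]; positivity))).exists
  set r := u n
  have hrT : Set.Ico r T ⊆ Set.Ico 0 T := Set.Ico_subset_Ico_left (hu n).1
  -- Across the gap heights differ by at least `η / 3` and the upper one is at most `M`; dividing
  -- the cubic bound by `(η / 3) ^ 3` gives this constant.
  set D := |C| * M / (η / 3) ^ 3 with hD
  have hD0 : 0 ≤ D := by positivity
  have key : ∀ t ∈ Set.Ico r T, ∀ i j, h i t < η / 3 → 2 * η / 3 < h j t →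
      |K i j t| ≤ D * h i t := by
    intro t ht i j hi hj
    have ht0 := hrT ht
    have h1 := H.abs_mul_pow_le t ht0 i j
    have h2 : (η / 3) ^ 3 ≤ |h i t - h j t| ^ 3 := by
      have : η / 3 ≤ |h i t - h j t| := by
        rw [abs_sub_comm]; exact le_trans (by linarith) (le_abs_self _)
      gcongr
    have hpi := H.pos t ht0 i
    have hpj := H.pos t ht0 j
    have h3 : C * (h i t * h j t) ≤ |C| * (h i t * M) := by
      have := le_abs_self C
      have := hle t ht0 j
      gcongr
    rw [hD, div_mul_eq_mul_div, le_div_iff₀ (by positivity)]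
    calc _ ≤ |K i j t| * |h i t - h j t| ^ 3 := by gcongr
      _ ≤ |C| * (h i t * M) := h1.trans h3
      _ = _ := by ring
  have hgapr : ∀ t ∈ Set.Ico r T, ∀ i, h i t < η / 3 ∨ 2 * η / 3 < h i t := fun t ht =>
    hgap t ⟨hn1.le.trans ht.1, ht.2⟩
  -- Two vortices in the same group have equal derivative weights, so only mixed pairs contribute.
  have hq : ∀ t ∈ Set.Ico r T, ∀ i j, |K i j t * ((if h i t < η / 2 then 1 else 0) -
      (if h j t < η / 2 then 1 else 0))| ≤
        D * truncId (η / 2) (h i t) + D * truncId (η / 2) (h j t) := by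
    intro t ht i j
    rcases hgapr t ht i with hi | hi <;> rcases hgapr t ht j with hj | hj
    · have hpi := H.pos t (hrT ht) i
      have hpj := H.pos t (hrT ht) j
      rw [if_pos (by linarith), if_pos (by linarith), sub_self, mul_zero, abs_zero]
      exact add_nonneg (mul_nonneg hD0 (truncId_nonneg hpi.le))
        (mul_nonneg hD0 (truncId_nonneg hpj.le))
    · have hi' : h i t < η / 2 := by linarith
      have hj' : ¬ h j t < η / 2 := by linarith
      simpa [truncId, hi', hj'] using key t ht i j hi hj
    · have hj' : h j t < η / 2 := by linarith
      have hi' : ¬ h i t < η / 2 := by linarith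
      have := key t ht j i hj hi
      rw [H.antisymm t (hrT ht), abs_neg] at this
      simpa [truncId, hi', hj'] using this
    · have hj' : ¬ h j t < η / 2 := by linarith
      have hi' : ¬ h i t < η / 2 := by linarith
      simp [truncId, hi', hj']
  have hFpos : 0 < ∑ i, a i * truncId (η / 2) (h i r) := by
    refine Finset.sum_pos' (fun i _ => mul_nonneg (H.weight_pos i).le
      (truncId_nonneg (H.pos r (hu n) i).le)) ⟨i₀, Finset.mem_univ _, ?_⟩
    rw [truncId, if_pos hn2]
    exact mul_pos (H.weight_pos i₀) (H.pos r (hu n) i₀)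
  obtain ⟨c, hc, hcF⟩ := exists_pos_le_of_abs_deriv_le (s := r) (T := T)
    (C := (∑ i, a i) * D) (F := fun t => ∑ i, a i * truncId (η / 2) (h i t))
    (fun t ht => (H.hasDerivWithinAt_sum (hrT ht) fun i => hasDerivAt_truncId (by
      rcases hgapr t ht i with h1 | h1
      · exact (by linarith : h i t < η / 2).ne
      · exact (by linarith : η / 2 < h i t).ne')).mono hrT)
    (fun t ht => (abs_sum_antisymm_le H.weight_pos (H.antisymm t (hrT ht)) (hq t ht)).trans_eq
      (by simp only [Finset.mul_sum]; exact Finset.sum_congr rfl fun i _ => by ring))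
    hFpos (hu n).2
  -- Low limits are 0 and high limits are truncated to 0, while `η / 2` is not itself a limit
  -- height.
  have hlim : Tendsto (fun n => ∑ i, a i * truncId (η / 2) (h i (u n))) atTop (𝓝 0) := by
    have hY0 : ∀ i, 0 ≤ Y i := fun i =>
      ge_of_tendsto (hY i) (Eventually.of_forall fun n => (H.pos _ (hu n) i).le)
    have hz : ∀ i, truncId (η / 2) (Y i) = 0 := fun i => by
      rcases hYη i with h1 | h1
      · rw [le_antisymm h1 (hY0 i)]; simp [truncId]
      · rw [truncId, if_neg (by linarith)]
    have h0 : ∑ i, a i * truncId (η / 2) (Y i) = 0 :=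
      Finset.sum_eq_zero fun i _ => by rw [hz, mul_zero]
    rw [← h0]
    refine tendsto_finsetSum _ fun i _ => Tendsto.const_mul _ ?_
    refine (hasDerivAt_truncId ?_).continuousAt.tendsto.comp (hY i)
    rcases hYη i with h1 | h1
    · exact (by linarith : Y i < η / 2).ne
    · exact (by linarith : η / 2 < Y i).ne'
  obtain ⟨m, hm1, hm2⟩ := ((huT.eventually_const_lt (hu n).2).and
    (hlim.eventually_lt_const hc)).exists
  exact hm2.not_ge (hcF (u m) ⟨hm1.le, (hu m).2⟩)

end IsHeightFlow
end PointVortex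

/-! ### Gradients of the Green and Robin functions -/

namespace PointVortex

theorem gradient_green_halfPlane {x y : ℂ} (hxy : x ≠ y) (hxy' : x ≠ (starRingEnd ℂ) y) :
    gradient (fun z => Domain.halfPlane.green z y) x =
      (((1 / (2 * Real.pi) : ℝ)) : ℂ) * ((((‖x - y‖ ^ 2)⁻¹ : ℝ) : ℂ) * (x - y) -
        (((‖x - (starRingEnd ℂ) y‖ ^ 2)⁻¹ : ℝ) : ℂ) * (x - (starRingEnd ℂ) y)) := by
  refine HasGradientAt.gradient ?_
  have h1 := hasGradientAt_log_norm_affine 1 (-y) (z := x)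
    (by rw [one_mul, ← sub_eq_add_neg]; exact sub_ne_zero.2 hxy)
  have h2 := hasGradientAt_log_norm_affine 1 (-(starRingEnd ℂ) y) (z := x)
    (by rw [one_mul, ← sub_eq_add_neg]; exact sub_ne_zero.2 hxy')
  simp only [one_mul, ← sub_eq_add_neg, map_one] at h1 h2
  rw [hasGradientAt_iff_hasFDerivAt] at h1 h2 ⊢
  refine ((h1.const_mul (1 / (2 * Real.pi))).add
    (h2.const_mul (-(1 / (2 * Real.pi))))).congr_fderiv ?_
  refine ContinuousLinearMap.ext fun v => ?_
  simp only [add_apply, smul_apply,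
    InnerProductSpace.toDual_apply_apply, Complex.inner, smul_eq_mul]
  simp [-Complex.ofReal_inv]
  ring

theorem gradient_green_unitDisk {x y : ℂ} (hxy : x ≠ y)
    (hxy' : 1 - x * (starRingEnd ℂ) y ≠ 0) :
    gradient (fun z => Domain.unitDisk.green z y) x =
      (((1 / (2 * Real.pi) : ℝ)) : ℂ) * ((((‖x - y‖ ^ 2)⁻¹ : ℝ) : ℂ) * (x - y) +
        (((‖1 - x * (starRingEnd ℂ) y‖ ^ 2)⁻¹ : ℝ) : ℂ) *
          (y * (1 - x * (starRingEnd ℂ) y))) := by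
  refine HasGradientAt.gradient ?_
  have h1 := hasGradientAt_log_norm_affine 1 (-y) (z := x)
    (by rw [one_mul, ← sub_eq_add_neg]; exact sub_ne_zero.2 hxy)
  have e : ∀ z, -(starRingEnd ℂ) y * z + 1 = 1 - z * (starRingEnd ℂ) y := fun z => by ring
  have h2 := hasGradientAt_log_norm_affine (-(starRingEnd ℂ) y) 1 (z := x) (by rwa [e])
  simp only [one_mul, ← sub_eq_add_neg, map_one, e, map_neg, Complex.conj_conj] at h1 h2
  rw [hasGradientAt_iff_hasFDerivAt] at h1 h2 ⊢
  refine ((h1.const_mul (1 / (2 * Real.pi))).add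
    (h2.const_mul (-(1 / (2 * Real.pi))))).congr_fderiv ?_
  refine ContinuousLinearMap.ext fun v => ?_
  simp only [add_apply, smul_apply,
    InnerProductSpace.toDual_apply_apply, Complex.inner, smul_eq_mul]
  simp [-Complex.ofReal_inv]
  ring

/-- The gradient of Robin's function of the half-plane is vertical. -/
theorem gradient_robin_halfPlane_re {x : ℂ} (hx : 0 < x.im) :
    (gradient Domain.halfPlane.robin x).re = 0 := by
  have he : Domain.halfPlane.robin = fun z : ℂ =>
      -(1 / (2 * Real.pi)) * Real.log (2 * z.im) := by
    funext z
    simp only [Domain.robin, Domain.regularPart, Complex.sub_conj]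
    simp [abs_mul, ← Real.log_abs (2 * z.im)]
  have h := (((Complex.imCLM.hasFDerivAt (x := x)).const_mul 2).log
    (by simpa using hx.ne')).const_mul (-(1 / (2 * Real.pi)))
  have h1 : fderiv ℝ Domain.halfPlane.robin x 1 = 0 := by
    simp only [Complex.imCLM_apply] at h
    rw [he, h.fderiv]
    simp
  rw [← inner_gradient_left] at h1
  simpa only [Complex.inner, mul_one, Complex.one_re, one_mul, Complex.conj_re] using h1

/-- The gradient of Robin's function of the disk is radial. -/
theorem inner_mul_I_gradient_robin_unitDisk {x : ℂ} (hx : ‖x‖ < 1) :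
    inner ℝ x (Complex.I * gradient Domain.unitDisk.robin x) = 0 := by
  have he : Domain.unitDisk.robin = fun z : ℂ =>
      -(1 / (2 * Real.pi)) * Real.log (1 - ‖z‖ ^ 2) := by
    funext z
    have : 1 - z * (starRingEnd ℂ) z = ((1 - ‖z‖ ^ 2 : ℝ) : ℂ) := by
      rw [Complex.mul_conj, Complex.normSq_eq_norm_sq]; push_cast; rfl
    simp only [Domain.robin, Domain.regularPart, this, Complex.norm_real, Real.norm_eq_abs,
      Real.log_abs]
  have h0 : 1 - ‖x‖ ^ 2 ≠ 0 := by nlinarith [norm_nonneg x]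
  have h := (((hasStrictFDerivAt_norm_sq x).hasFDerivAt.const_sub 1).log h0).const_mul
    (-(1 / (2 * Real.pi)))
  -- The function depends only on `‖z‖`, and `Complex.I * x` is tangent to the circle through `x`.
  have h1 : fderiv ℝ Domain.unitDisk.robin x (Complex.I * x) = 0 := by
    rw [he, h.fderiv]
    simp [innerSL_apply_apply, Complex.inner]
    right; ring
  rw [← inner_gradient_left] at h1
  generalize gradient Domain.unitDisk.robin x = g at h1
  simp only [Complex.inner, Complex.mul_re, Complex.mul_im, Complex.conj_re, Complex.conj_im,
    Complex.I_re, Complex.I_im] at h1 ⊢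
  linarith

end PointVortex

/-! ### Kernel estimates and reduction to height flows -/

namespace PointVortex

/-- Here `D = ‖x - y‖ ^ 2`, `E` is its image counterpart, `w` is proportional to the product of
heights and `d` is the height gap. Since `D⁻¹ - E⁻¹ = w / (D * E)`, one factor `d` joins `n` to
cancel `D`, leaving `w / E ≤ 1`; two further factors `d` cancel `E`. -/
theorem abs_kernel_mul_le {c n D E d w m : ℝ} (hc : 0 ≤ c) (hd : 0 ≤ d) (hw : 0 < w)
    (hm : 0 ≤ m) (hD : 0 ≤ D) (hE : E = D + w) (hn : |n| * d ≤ m * D) (hdD : d ^ 2 ≤ m * D) :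
    |c * (n * (D⁻¹ - E⁻¹))| * d ≤ c * m ∧
      |c * (n * (D⁻¹ - E⁻¹))| * d ^ 3 ≤ c * m ^ 2 * w := by
  rcases hD.eq_or_lt with rfl | hD
  -- Coincident points, in particular `i = j`: both left sides vanish with `d`.
  · have : d = 0 := by nlinarith
    subst this
    constructor <;> simp <;> positivity
  have hE0 : 0 < E := by linarith
  have h1 : |c * (n * (D⁻¹ - E⁻¹))| = c * (|n| * (w / (D * E))) := by
    have : D⁻¹ - E⁻¹ = w / (D * E) := by field_simp; linarith
    rw [this, abs_mul, abs_mul, abs_of_nonneg hc, abs_of_pos (by positivity : 0 < w / (D * E))]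
  have h2 : |c * (n * (D⁻¹ - E⁻¹))| * d ≤ c * (m * (w / E)) := by
    calc _ = c * (|n| * d * (w / (D * E))) := by rw [h1]; ring
      _ ≤ c * (m * D * (w / (D * E))) := by gcongr
      _ = _ := by field_simp
  constructor
  · refine h2.trans ?_
    have : w / E ≤ 1 := (div_le_one hE0).2 (by linarith)
    nlinarith [mul_nonneg hc hm]
  · calc _ = |c * (n * (D⁻¹ - E⁻¹))| * d * d ^ 2 := by ring
      _ ≤ c * (m * (w / E)) * (m * E) := by
        gcongr
        exact hdD.trans (by gcongr; linarith)
      _ = _ := by field_simp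

/-- The rate of change of the ordinate of a vortex `x` in the half-plane due to a vortex `y` of
unit intensity. -/
noncomputable def halfPlaneKernel (x y : ℂ) : ℝ :=
  1 / (2 * Real.pi) * ((x.re - y.re) *
    ((‖x - y‖ ^ 2)⁻¹ - (‖x - (starRingEnd ℂ) y‖ ^ 2)⁻¹))

/-- The rate of change of `1 - |x|²` for a vortex `x` in the unit disk due to a vortex `y` of
unit intensity. -/
noncomputable def unitDiskKernel (x y : ℂ) : ℝ :=
  1 / Real.pi * ((x * (starRingEnd ℂ) y).im *
    ((‖x - y‖ ^ 2)⁻¹ - (‖1 - x * (starRingEnd ℂ) y‖ ^ 2)⁻¹))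

theorem halfPlaneKernel_antisymm (x y : ℂ) : halfPlaneKernel y x = -halfPlaneKernel x y := by
  have h : ‖y - (starRingEnd ℂ) x‖ = ‖x - (starRingEnd ℂ) y‖ := by
    rw [← RCLike.norm_conj, map_sub, Complex.conj_conj, norm_sub_rev]
  rw [halfPlaneKernel, halfPlaneKernel, h, norm_sub_rev y x]; ring

theorem unitDiskKernel_antisymm (x y : ℂ) : unitDiskKernel y x = -unitDiskKernel x y := by
  have h : ‖1 - y * (starRingEnd ℂ) x‖ = ‖1 - x * (starRingEnd ℂ) y‖ := by
    rw [← RCLike.norm_conj, map_sub, map_mul, Complex.conj_conj, map_one, mul_comm]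
  have h' : (y * (starRingEnd ℂ) x).im = -(x * (starRingEnd ℂ) y).im := by
    simp; ring
  rw [unitDiskKernel, unitDiskKernel, h, h', norm_sub_rev y x]; ring

theorem abs_halfPlaneKernel_mul_le {x y : ℂ} (hx : 0 < x.im) (hy : 0 < y.im) :
    |halfPlaneKernel x y| * |x.im - y.im| ≤ 1 ∧
      |halfPlaneKernel x y| * |x.im - y.im| ^ 3 ≤ 1 * (x.im * y.im) := by
  have hD : ‖x - y‖ ^ 2 = (x.re - y.re) ^ 2 + (x.im - y.im) ^ 2 := by
    rw [Complex.sq_norm, Complex.normSq_apply]; simp; ring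
  have hE : ‖x - (starRingEnd ℂ) y‖ ^ 2 = ‖x - y‖ ^ 2 + 4 * (x.im * y.im) := by
    rw [hD, Complex.sq_norm, Complex.normSq_apply]; simp; ring
  have hxy := mul_pos hx hy
  obtain ⟨h1, h2⟩ := abs_kernel_mul_le (c := 1 / (2 * Real.pi)) (n := x.re - y.re)
    (d := |x.im - y.im|) (m := 1) (by positivity) (abs_nonneg _)
    (by positivity : 0 < 4 * (x.im * y.im)) zero_le_one (sq_nonneg ‖x - y‖) hE
    (by
      rw [hD, ← sq_abs (x.re - y.re), ← sq_abs (x.im - y.im)]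
      nlinarith [sq_nonneg (|x.re - y.re| - |x.im - y.im|), sq_nonneg |x.re - y.re|,
        sq_nonneg |x.im - y.im|])
    (by rw [hD, sq_abs]; nlinarith [sq_nonneg (x.re - y.re)])
  -- Absorbs the factor 4 in `w = 4 * (x.im * y.im)`.
  have hpi : 1 / (2 * Real.pi) ≤ 1 / 4 := by
    have := Real.pi_gt_three
    gcongr
    linarith
  refine ⟨h1.trans (by linarith), h2.trans ?_⟩
  nlinarith

theorem abs_unitDiskKernel_mul_le {x y : ℂ} (hx : ‖x‖ < 1) (hy : ‖y‖ < 1) :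
    |unitDiskKernel x y| * |(1 - ‖x‖ ^ 2) - (1 - ‖y‖ ^ 2)| ≤ 16 ∧
      |unitDiskKernel x y| * |(1 - ‖x‖ ^ 2) - (1 - ‖y‖ ^ 2)| ^ 3 ≤
        16 * ((1 - ‖x‖ ^ 2) * (1 - ‖y‖ ^ 2)) := by
  have hE : ‖1 - x * (starRingEnd ℂ) y‖ ^ 2 =
      ‖x - y‖ ^ 2 + (1 - ‖x‖ ^ 2) * (1 - ‖y‖ ^ 2) := by
    simp only [Complex.sq_norm, Complex.normSq_apply]; simp; ring
  have hx1 : 0 < 1 - ‖x‖ ^ 2 := by nlinarith [norm_nonneg x]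
  have hy1 : 0 < 1 - ‖y‖ ^ 2 := by nlinarith [norm_nonneg y]
  have hxy := mul_pos hx1 hy1
  -- Subtracting the real number `y * (starRingEnd ℂ) y` does not change the imaginary part.
  have hn : |(x * (starRingEnd ℂ) y).im| ≤ ‖x - y‖ := by
    have : (x * (starRingEnd ℂ) y).im = ((x - y) * (starRingEnd ℂ) y).im := by
      simp; ring
    rw [this]
    refine (Complex.abs_im_le_norm _).trans ?_
    rw [norm_mul, RCLike.norm_conj]
    nlinarith [norm_nonneg (x - y)]
  have hd : |(1 - ‖x‖ ^ 2) - (1 - ‖y‖ ^ 2)| ≤ 2 * ‖x - y‖ := by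
    have : (1 - ‖x‖ ^ 2) - (1 - ‖y‖ ^ 2) = (‖y‖ - ‖x‖) * (‖y‖ + ‖x‖) := by ring
    rw [this, abs_mul, mul_comm, abs_of_nonneg (by positivity : 0 ≤ ‖y‖ + ‖x‖), norm_sub_rev]
    have := abs_norm_sub_norm_le y x
    gcongr
    linarith
  obtain ⟨h1, h2⟩ := abs_kernel_mul_le (c := 1 / Real.pi) (n := (x * (starRingEnd ℂ) y).im)
    (d := |(1 - ‖x‖ ^ 2) - (1 - ‖y‖ ^ 2)|) (m := 4) (by positivity) (abs_nonneg _)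
    hxy (by norm_num) (sq_nonneg ‖x - y‖) hE
    (by
      calc _ ≤ ‖x - y‖ * (2 * ‖x - y‖) := by gcongr
        _ ≤ _ := by nlinarith [sq_nonneg ‖x - y‖])
    (by
      calc _ ≤ (2 * ‖x - y‖) ^ 2 := by gcongr
        _ = _ := by ring)
  have hpi : 1 / Real.pi ≤ 1 := by
    have := Real.pi_gt_three
    rw [div_le_one (by positivity)]
    linarith
  refine ⟨h1.trans (by linarith), h2.trans ?_⟩
  nlinarith

theorem velocity_halfPlane_im {N : ℕ} (a : Fin N → ℝ) {X : Fin N → ℂ}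
    (hX : ∀ i, 0 < (X i).im) (hinj : ∀ i j, i ≠ j → X i ≠ X j) (i : Fin N) :
    (velocity .halfPlane a X i).im =
      ∑ j ∈ Finset.univ.erase i, a j * halfPlaneKernel (X i) (X j) := by
  rw [velocity, Complex.add_im, Complex.im_sum, Complex.im_ofReal_mul]
  have h0 : (perpGrad Domain.halfPlane.robin (X i)).im = 0 := by
    simp [perpGrad, gradient_robin_halfPlane_re (hX i)]
  rw [h0, mul_zero, add_zero]
  refine Finset.sum_congr rfl fun j hj => ?_
  have hne : X i ≠ (starRingEnd ℂ) (X j) := fun h => by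
    have h1 := congrArg Complex.im h
    rw [Complex.conj_im] at h1
    linarith [hX i, hX j]
  rw [Complex.im_ofReal_mul, perpGrad,
    gradient_green_halfPlane (hinj i j (Finset.ne_of_mem_erase hj).symm) hne, halfPlaneKernel]
  generalize (‖X i - X j‖ ^ 2)⁻¹ = p
  generalize (‖X i - (starRingEnd ℂ) (X j)‖ ^ 2)⁻¹ = q
  generalize 1 / (2 * Real.pi) = r
  simp
  ring_nf
  simp

/-- The left side is the derivative of `1 - ‖X i‖ ^ 2` along the motion; the Robin velocity is
tangent to circles and drops out. -/
theorem inner_velocity_unitDisk {N : ℕ} (a : Fin N → ℝ) {X : Fin N → ℂ}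
    (hX : ∀ i, ‖X i‖ < 1) (hinj : ∀ i j, i ≠ j → X i ≠ X j) (i : Fin N) :
    -(2 * inner ℝ (X i) (velocity .unitDisk a X i)) =
      ∑ j ∈ Finset.univ.erase i, a j * unitDiskKernel (X i) (X j) := by
  have hsmul : ∀ (r : ℝ) (z : ℂ), inner ℝ (X i) ((r : ℂ) * z) = r * inner ℝ (X i) z :=
    fun r z => by rw [← Complex.real_smul, real_inner_smul_right]
  rw [velocity, inner_add_right, inner_sum, hsmul, perpGrad,
    inner_mul_I_gradient_robin_unitDisk (hX i), mul_zero, add_zero, Finset.mul_sum,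
    ← Finset.sum_neg_distrib]
  refine Finset.sum_congr rfl fun j hj => ?_
  have hne : 1 - X i * (starRingEnd ℂ) (X j) ≠ 0 := fun h => by
    have h1 : ‖X i * (starRingEnd ℂ) (X j)‖ = 1 := by rw [← sub_eq_zero.mp h]; simp
    rw [norm_mul, RCLike.norm_conj] at h1
    nlinarith [hX i, hX j, norm_nonneg (X i), norm_nonneg (X j)]
  have hk : unitDiskKernel (X i) (X j) = 2 * (1 / (2 * Real.pi) *
      ((X i * (starRingEnd ℂ) (X j)).im *
        ((‖X i - X j‖ ^ 2)⁻¹ - (‖1 - X i * (starRingEnd ℂ) (X j)‖ ^ 2)⁻¹))) := by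
    rw [unitDiskKernel]; field_simp
  rw [hsmul, perpGrad,
    gradient_green_unitDisk (hinj i j (Finset.ne_of_mem_erase hj).symm) hne, hk]
  generalize (‖X i - X j‖ ^ 2)⁻¹ = p
  generalize (‖1 - X i * (starRingEnd ℂ) (X j)‖ ^ 2)⁻¹ = q
  generalize 1 / (2 * Real.pi) = r
  simp [Complex.inner]
  ring

theorem IsSolution.isHeightFlow_halfPlane {N : ℕ} {a : Fin N → ℝ} (ha : ∀ i, 0 < a i)
    {x₀ : Fin N → ℂ} {T : ℝ} {x : Fin N → ℝ → ℂ} (hx : IsSolution .halfPlane a x₀ T x) :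
    IsHeightFlow a T 1 (fun i t => (x i t).im)
      (fun i j t => halfPlaneKernel (x i t) (x j t)) where
  weight_pos := ha
  pos := hx.mem_domain
  antisymm _ _ _ _ := halfPlaneKernel_antisymm _ _
  deriv t ht i := by
    rw [← velocity_halfPlane_im a (hx.mem_domain t ht) (hx.distinct t ht) i]
    exact Complex.imCLM.hasFDerivAt.comp_hasDerivWithinAt t (hx.motion t ht i)
  abs_mul_le t ht i j :=
    (abs_halfPlaneKernel_mul_le (hx.mem_domain t ht i) (hx.mem_domain t ht j)).1
  abs_mul_pow_le t ht i j :=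
    (abs_halfPlaneKernel_mul_le (hx.mem_domain t ht i) (hx.mem_domain t ht j)).2

theorem IsSolution.isHeightFlow_unitDisk {N : ℕ} {a : Fin N → ℝ} (ha : ∀ i, 0 < a i)
    {x₀ : Fin N → ℂ} {T : ℝ} {x : Fin N → ℝ → ℂ} (hx : IsSolution .unitDisk a x₀ T x) :
    IsHeightFlow a T 16 (fun i t => 1 - ‖x i t‖ ^ 2)
      (fun i j t => unitDiskKernel (x i t) (x j t)) :=
  have hn : ∀ t ∈ Set.Ico 0 T, ∀ i, ‖x i t‖ < 1 := fun t ht i =>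
    mem_ball_zero_iff.1 (hx.mem_domain t ht i)
  { weight_pos := ha
    pos := fun t ht i => by nlinarith [hn t ht i, norm_nonneg (x i t)]
    antisymm := fun _ _ _ _ => unitDiskKernel_antisymm _ _
    deriv := fun t ht i => by
      rw [← inner_velocity_unitDisk a (hn t ht) (hx.distinct t ht) i]
      exact (hx.motion t ht i).norm_sq.const_sub 1
    abs_mul_le := fun t ht i j => (abs_unitDiskKernel_mul_le (hn t ht i) (hn t ht j)).1
    abs_mul_pow_le := fun t ht i j => (abs_unitDiskKernel_mul_le (hn t ht i) (hn t ht j)).2 }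

/-! ### From heights to distance from the boundary -/

theorem ofReal_le_infEDist_frontier_halfPlane {x : ℂ} {c : ℝ} (hc : c ≤ x.im) :
    ENNReal.ofReal c ≤ Metric.infEDist x (frontier Domain.halfPlane.carrier) := by
  refine Metric.le_infEDist.2 fun z hz => ?_
  have hz' : z.im = 0 := by
    have : z ∈ frontier {z : ℂ | 0 < z.im} := hz
    rwa [Complex.frontier_setOfPred_lt_im] at this
  rw [edist_dist, dist_eq_norm]
  refine ENNReal.ofReal_le_ofReal ?_
  have h1 := Complex.abs_im_le_norm (x - z)
  rw [Complex.sub_im, hz', sub_zero] at h1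
  exact hc.trans ((le_abs_self _).trans h1)

/-- The halving comes from `1 - ‖x‖ ^ 2 = (1 - ‖x‖) * (1 + ‖x‖) ≤ 2 * (1 - ‖x‖)`. -/
theorem ofReal_le_infEDist_frontier_unitDisk {x : ℂ} {c : ℝ} (hx : ‖x‖ < 1)
    (hc : c ≤ 1 - ‖x‖ ^ 2) :
    ENNReal.ofReal (c / 2) ≤ Metric.infEDist x (frontier Domain.unitDisk.carrier) := by
  refine Metric.le_infEDist.2 fun z hz => ?_
  have hz' : ‖z‖ = 1 := by
    have : z ∈ frontier (Metric.ball (0 : ℂ) 1) := hz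
    simpa [frontier_ball (0 : ℂ) one_ne_zero] using this
  rw [edist_dist, dist_eq_norm]
  refine ENNReal.ofReal_le_ofReal ?_
  have h1 := norm_sub_norm_le z x
  rw [norm_sub_rev, hz'] at h1
  nlinarith [norm_nonneg x]

/-- The vortices stay at a positive distance from the boundary. -/
theorem IsSolution.exists_eventually_le_infEDist {Ω : Domain} {N : ℕ} {a : Fin N → ℝ}
    (ha : ∀ i, 0 < a i) {x₀ : Fin N → ℂ} {T : ℝ} (hT : 0 < T) {x : Fin N → ℝ → ℂ}
    (hx : IsSolution Ω a x₀ T x) (i : Fin N) :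
    ∃ c > 0, ∀ᶠ t in 𝓝[<] T, ENNReal.ofReal c ≤ Metric.infEDist (x i t) (frontier Ω.carrier) := by
  cases Ω with
  | halfPlane =>
    obtain ⟨c, hc, h⟩ := (hx.isHeightFlow_halfPlane ha).exists_eventually_le hT i
    exact ⟨c, hc, h.mono fun t ht => ofReal_le_infEDist_frontier_halfPlane ht⟩
  | unitDisk =>
    obtain ⟨c, hc, h⟩ := (hx.isHeightFlow_unitDisk ha).exists_eventually_le hT i
    refine ⟨c / 2, by positivity, ?_⟩
    filter_upwards [h, Ico_mem_nhdsLT hT] with t ht ht0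
    exact ofReal_le_infEDist_frontier_unitDisk
      (mem_ball_zero_iff.1 (hx.mem_domain t ht0 i)) ht

end PointVortex

theorem theorem3 (Ω : PointVortex.Domain) (N : ℕ) (a : Fin N → ℝ) (ha : ∀ i, 0 < a i)
    (x₀ : Fin N → ℂ) (hx₀_mem : ∀ i, x₀ i ∈ Ω.carrier) (hx₀_inj : Function.Injective x₀)
    (T : ℝ) (hT : 0 < T) (x : Fin N → ℝ → ℂ) (hx : PointVortex.IsSolution Ω a x₀ T x) :
    PointVortex.boundaryCluster Ω T x = ∅ := by
  refine Set.eq_empty_of_forall_notMem fun i hi => ?_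
  obtain ⟨c, hc, h⟩ := hx.exists_eventually_le_infEDist ha hT i
  have h1 := le_liminf_of_le (by isBoundedDefault) h
  rw [PointVortex.boundaryCluster, Set.mem_ofPred_eq] at hi
  rw [hi] at h1
  exact (ENNReal.ofReal_pos.2 hc).not_ge h1
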